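/- Let $m$ be the number of clients, $q_{\max}\ge 0$, $\mathcal C$ a finite set of network states. For each tolerance $\varepsilon>0$ let $h_\varepsilon:[0,q_{\max}]\to[0,\infty)$ be strictly increasing, continuous and bounded, and put $\boldsymbol h_\varepsilon(\boldsymbol q)=(h_\varepsilon(q_j))_{j=1}^m$ for $\boldsymbol q\in[0,q_{\max}]^m$. Let $\|\cdot\|$ be a norm on $\mathbb R^m$, and assume the following. (1) For every $\varepsilon>0$ and every sequence $(\boldsymbol q^n)_{n\ge1}$ of compression vectors in $[0,q_{\max}]^m$, the federated learning algorithm run with $(\boldsymbol q^n)_n$ has reached tolerance $\varepsilon$ by round $r\ge1$ if and only if $r>\frac1r\sum_{n=1}^r\|\boldsymbol h_\varepsilon(\boldsymbol q^n)\|$. (2) For every sequence $(\boldsymbol q^n)_n$, the minimum number $r_\varepsilon$ of rounds needed to reach tolerance $\varepsilon$ satisfies $r_\varepsilon=\Theta(1/p(\varepsilon))$ as $\varepsilon\to0^+$ for some nonzero polynomial $p$ with $p(0)=0$ (which, like the constants, may depend on the sequence). (3) The number $\tau$ of local computations per round is fixed, and for every state $\boldsymbol c\in\mathcal C$ the round duration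 $d(\tau,\boldsymbol q,\boldsymbol c)>0$ is bounded in $\boldsymbol q\in[0,q_{\max}]^m$ and, for every $\varepsilon>0$, the function $\boldsymbol r\mapsto d(\tau,\boldsymbol h_\varepsilon^{-1}(\boldsymbol r),\boldsymbol c)$ on the range of $\boldsymbol h_\varepsilon$ is convex and (not necessarily strictly) decreasing in every coordinate. (4) The network states $(\boldsymbol C^n)_{n\ge1}$ form a stationary, irreducible, aperiodic Markov chain on $\mathcal C$ with invariant distribution $\mu$. For a state-dependent stationary policy $\pi:\mathcal C\to[0,q_{\max}]^m$ let $R_\varepsilon^\pi$ be the minimum number of rounds needed to reach tolerance $\varepsilon$ with $\boldsymbol q^n=\pi(\boldsymbol C^n)$, and let $T_\varepsilon^\pi=\sum_{n=1}^{R_\varepsilon^\pi}d(\tau,\pi(\boldsymbol C^n),\boldsymbol C^n)$ be the wall clock time. Let $\boldsymbol C$ be a random variable with distribution $\mu$. Then for every $\delta>0$ there is $\varepsilon_{th}>0$ such that for all $0<\varepsilon<\varepsilon_{th}$ and every state-dependent stationary policy $\pi$, the number $R_\varepsilon^\pi$ is finite, $T_\varepsilon^\pi$ is integrable, $\mathbb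 E[\|\boldsymbol h_\varepsilon(\pi(\boldsymbol C))\|]\,\mathbb E[d(\tau,\pi(\boldsymbol C),\boldsymbol C)]>0$, and $$1-\delta\ \le\ \frac{\mathbb E[T_\varepsilon^\pi]}{\mathbb E[\|\boldsymbol h_\varepsilon(\pi(\boldsymbol C))\|]\;\mathbb E[d(\tau,\pi(\boldsymbol C),\boldsymbol C)]}\ \le\ 1+\delta .$$ -/

import Mathlib

open MeasureTheory

namespace FLComp

/-- Vectors of compression parameters of `m` clients, each parameter in `[0, qmax]`. -/
abbrev CompVec (m : ℕ) (qmax : ℝ) : Type := Fin m → Set.Icc (0 : ℝ) qmax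

/-- Sequences of compression vectors; the entry with index `n` is the one used in round `n + 1`,
so that the rounds `1, …, r` correspond to `Finset.range r`. -/
abbrev CompSeq (m : ℕ) (qmax : ℝ) : Type := ℕ → CompVec m qmax

/-- The convergence behaviour of a federated learning algorithm: `reached ε q r` says that, run
with the sequence `q` of compression vectors, the algorithm has reached tolerance `ε` by
round `r`. No property is built in. -/
abbrev Convergence (m : ℕ) (qmax : ℝ) : Type := ℝ → CompSeq m qmax → ℕ → Prop

/-- The vector function that applies the scalar function `h` to every coordinate. -/
def vecH {m : ℕ} {qmax : ℝ} (h : Set.Icc (0 : ℝ) qmax → ℝ) (q : CompVec m qmax) : Fin m → ℝ :=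
  fun j => h (q j)

/-- The minimum number of rounds needed to reach tolerance `ε` under the sequence `q`. -/
noncomputable def minRounds {m : ℕ} {qmax : ℝ} (reached : Convergence m qmax) (ε : ℝ)
    (q : CompSeq m qmax) : ℕ :=
  sInf {r : ℕ | 1 ≤ r ∧ reached ε q r}

/-- A seminorm on `ℝ^m` which is a norm. -/
def IsNorm {m : ℕ} (N : Seminorm ℝ (Fin m → ℝ)) : Prop := ∀ x, N x = 0 → x = 0

/-- For every tolerance `ε`, the function `h ε` is nonnegative, strictly increasing, continuous and
bounded, `N` is a norm, and tolerance `ε` has been reached by round `r` if and only if `r` exceeds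
the average of `N (vecH (h ε) (q n))` over the first `r` rounds. -/
structure RoundsCriterion {m : ℕ} {qmax : ℝ} (reached : Convergence m qmax)
    (h : ℝ → Set.Icc (0 : ℝ) qmax → ℝ) (N : Seminorm ℝ (Fin m → ℝ)) : Prop where
  isNorm : IsNorm N
  nonneg : ∀ ε > 0, ∀ x, 0 ≤ h ε x
  strictMono : ∀ ε > 0, StrictMono (h ε)
  continuous : ∀ ε > 0, Continuous (h ε)
  bounded : ∀ ε > 0, Bornology.IsBounded (Set.range (h ε))
  reached_iff : ∀ ε > 0, ∀ (q : CompSeq m qmax) (r : ℕ), 1 ≤ r →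
    (reached ε q r ↔ (r : ℝ) > (1 / (r : ℝ)) * ∑ n ∈ Finset.range r, N (vecH (h ε) (q n)))

/-- For every sequence of compression vectors, the minimum number of rounds is
`Θ(1 / poly(ε))` as `ε → 0+`, for a nonzero polynomial that vanishes at `0` (so that the number of
rounds grows). The polynomial and the constants may depend on the sequence. -/
def RoundsGrowth {m : ℕ} {qmax : ℝ} (reached : Convergence m qmax) : Prop :=
  ∀ q : CompSeq m qmax, ∃ p : Polynomial ℝ, p ≠ 0 ∧ p.eval 0 = 0 ∧
    Asymptotics.IsTheta (nhdsWithin (0 : ℝ) (Set.Ioi 0))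
      (fun ε : ℝ => (minRounds reached ε q : ℝ)) (fun ε : ℝ => 1 / p.eval ε)

/-- The duration of a round as a function of `r = vecH h q`, i.e. `r ↦ f (vecH h ⁻¹ r)`; it is
meaningful on the range of `vecH h`, when `h` is injective. -/
noncomputable def durationOfRate {m : ℕ} {qmax : ℝ} (h : Set.Icc (0 : ℝ) qmax → ℝ)
    (f : CompVec m qmax → ℝ) : (Fin m → ℝ) → ℝ :=
  Function.extend (vecH h) f (fun _ => 0)

/-- For the given number `τ` of local computations and every network state `c`, the round duration
is positive and bounded, and as a function of `r = vecH (h ε) q` it is convex and decreasing in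
every coordinate. -/
structure DurationAssumption {m : ℕ} {qmax : ℝ} {S : Type*}
    (d : ℕ → CompVec m qmax → S → ℝ) (τ : ℕ) (h : ℝ → Set.Icc (0 : ℝ) qmax → ℝ) : Prop where
  pos : ∀ c q, 0 < d τ q c
  bounded : ∀ c, Bornology.IsBounded (Set.range fun q => d τ q c)
  convex : ∀ ε > 0, ∀ c, ConvexOn ℝ (Set.range (vecH (m := m) (h ε)))
    (durationOfRate (h ε) fun q => d τ q c)
  decreasing : ∀ ε > 0, ∀ c, AntitoneOn (durationOfRate (h ε) fun q => d τ q c)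
    (Set.range (vecH (m := m) (h ε)))

/-- Every state has period `1`: the only common divisor of the possible return times is `1`. -/
def Aperiodic {S : Type*} [Fintype S] [DecidableEq S] (M : Matrix S S ℝ) : Prop :=
  ∀ c : S, ∀ k : ℕ, (∀ n : ℕ, 1 ≤ n → 0 < (M ^ n) c c → k ∣ n) → k = 1

/-- `C 0, C 1, …` (the network states in rounds `1, 2, …`) is a stationary Markov chain on the
finite set `S` whose transition matrix `M` is irreducible and aperiodic and whose invariant
distribution is `μ`. -/
structure IsStationaryMarkovChain {S : Type*} [Fintype S] [DecidableEq S] [MeasurableSpace S]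
    {Ω : Type*} [MeasurableSpace Ω] (Pr : Measure Ω) (C : ℕ → Ω → S)
    (M : Matrix S S ℝ) (μ : S → ℝ) : Prop where
  measurable : ∀ n, Measurable (C n)
  stochastic : M ∈ Matrix.rowStochastic ℝ S
  irreducible : M.IsIrreducible
  aperiodic : Aperiodic M
  distribution : μ ∈ stdSimplex ℝ S
  invariant : Matrix.vecMul μ M = μ
  law : ∀ (n : ℕ) (c : ℕ → S),
    Pr.real {ω | ∀ i ≤ n, C i ω = c i} = μ (c 0) * ∏ i ∈ Finset.range n, M (c i) (c (i + 1))

/-- The expectation of `f C` for a random variable `C` with distribution `μ` on a finite set. -/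
def mean {S : Type*} [Fintype S] (μ : S → ℝ) (f : S → ℝ) : ℝ := ∑ c, μ c * f c

/-- The sequence of compression vectors that the state-dependent stationary policy `π` produces
on the sequence `C` of network states, at the outcome `ω`. -/
def policySeq {m : ℕ} {qmax : ℝ} {S Ω : Type*} (π : S → CompVec m qmax) (C : ℕ → Ω → S)
    (ω : Ω) : CompSeq m qmax :=
  fun n => π (C n ω)

/-- The random minimum number of rounds needed to reach tolerance `ε` under the policy `π`. -/
noncomputable def policyRounds {m : ℕ} {qmax : ℝ} {S Ω : Type*} (reached : Convergence m qmax)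
    (ε : ℝ) (π : S → CompVec m qmax) (C : ℕ → Ω → S) (ω : Ω) : ℕ :=
  minRounds reached ε (policySeq π C ω)

/-- The random wall clock time needed to reach tolerance `ε` under the policy `π`, with `τ` local
computations in every round. -/
noncomputable def wallClock {m : ℕ} {qmax : ℝ} {S Ω : Type*} (reached : Convergence m qmax)
    (d : ℕ → CompVec m qmax → S → ℝ) (τ : ℕ)
    (ε : ℝ) (π : S → CompVec m qmax) (C : ℕ → Ω → S) (ω : Ω) : ℝ :=
  ∑ n ∈ Finset.range (policyRounds reached ε π C ω), d τ (π (C n ω)) (C n ω)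

end FLComp

/-! Fix a policy and put `a c = N (vecH (h ε) (π c))` and `b c = d τ (π c) c`. The stopping round is
the least `r ≥ 1` at which the sum of `a` along the chain drops below `r²`. If time averages are
close to means, this round is close to `mean μ a`, and the elapsed time is close to `mean μ a * mean
μ b`.

The difficulty is uniformity in `π` and `ε`. Both enter only through `a` and `b`, while the
randomness sits in the visit counts of finitely many states. The law of large numbers, proved from
the Poisson equation and second moments, gives a deterministic `K` and an event of probability near
one on which all visit counts after time `K` have small relative error (`exists_uniform_visits`).
This error passes unchanged to the sums of every nonnegative function. By `rate_large`, small `ε`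
forces `a ≥ K` for all policies at once, so stopping occurs after `K`.

Off the good event, `μ ≥ κ > 0` bounds maxima by means, and the elapsed time is at most `2 / κ ^ 2`
times the product of means (`sum_duration_le`). A small bad event therefore contributes little to
the expectation. -/

namespace FLComp

/-! ### Harmonic functions, the Poisson equation and the invariant distribution -/

section Chain

variable {S : Type*} [Fintype S] [DecidableEq S] {M : Matrix S S ℝ} {μ : S → ℝ}

/-- A function that is harmonic for an irreducible stochastic matrix is constant. -/
theorem harmonic_const (hM : M ∈ Matrix.rowStochastic ℝ S) (hirr : M.IsIrreducible)
    {g : S → ℝ} (hg : Matrix.mulVec M g = g) (i j : S) : g i = g j := by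
  have key : ∀ k : ℕ, Matrix.mulVec (M ^ k) g = g := by
    intro k
    induction k with
    | zero => simp
    | succ k ih => rw [pow_succ, ← Matrix.mulVec_mulVec, hg, ih]
  obtain ⟨x, -, hx⟩ := Finset.exists_max_image Finset.univ g ⟨i, Finset.mem_univ i⟩
  have hmax : ∀ y, g y = g x := by
    intro y
    obtain ⟨k, -, hk⟩ := (Matrix.isIrreducible_iff_exists_pow_pos hirr.nonneg).1 hirr x y
    have hMk : M ^ k ∈ Matrix.rowStochastic ℝ S := pow_mem hM k
    -- Maximum principle: at the maximiser `x` a weighted sum of nonnegative gaps vanishes, so the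
    -- gap at `y`, which has positive weight, is zero.
    have h1 : ∑ z, (M ^ k) x z * (g x - g z) = 0 := by
      have h2 := congrFun (key k) x
      simp only [Matrix.mulVec, dotProduct] at h2
      simp only [mul_sub, Finset.sum_sub_distrib, ← Finset.sum_mul,
        Matrix.sum_row_of_mem_rowStochastic hMk x, h2]
      ring
    have h3 := (Finset.sum_eq_zero_iff_of_nonneg (fun z _ => mul_nonneg
      (Matrix.nonneg_of_mem_rowStochastic hMk) (sub_nonneg.2 (hx z (Finset.mem_univ z))))).1 h1 y
      (Finset.mem_univ y)
    rcases mul_eq_zero.1 h3 with h4 | h4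
    · exact absurd h4 hk.ne'
    · linarith
  rw [hmax i, hmax j]

omit [DecidableEq S] in
theorem mean_mulVec (hinv : Matrix.vecMul μ M = μ) (g : S → ℝ) :
    mean μ (Matrix.mulVec M g) = mean μ g := by
  change μ ⬝ᵥ Matrix.mulVec M g = μ ⬝ᵥ g
  rw [Matrix.dotProduct_mulVec, hinv]

/-- The Poisson equation of an irreducible finite chain has a solution. -/
theorem exists_poisson (hM : M ∈ Matrix.rowStochastic ℝ S) (hirr : M.IsIrreducible)
    (hμ : μ ∈ stdSimplex ℝ S) (hinv : Matrix.vecMul μ M = μ) (f : S → ℝ) :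
    ∃ g : S → ℝ, ∀ c, g c - Matrix.mulVec M g c = f c - mean μ f := by
  have mean_add : ∀ u v : S → ℝ, mean μ (fun c => u c + v c) = mean μ u + mean μ v := by
    intro u v; simp [mean, mul_add, Finset.sum_add_distrib]
  have mean_sub : ∀ u v : S → ℝ, mean μ (fun c => u c - v c) = mean μ u - mean μ v := by
    intro u v; simp [mean, mul_sub, Finset.sum_sub_distrib]
  have mean_const : ∀ x : ℝ, mean μ (fun _ => x) = x := by
    intro x; simp [mean, ← Finset.sum_mul, hμ.2]
  -- `1 - M` kills constants; the rank-one term `mean μ` restores injectivity. Since `L` preserves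
  -- the mean, a preimage of `f` has mean `mean μ f`, which gives the Poisson equation.
  let L : (S → ℝ) →ₗ[ℝ] (S → ℝ) :=
    { toFun := fun g c => g c - Matrix.mulVec M g c + mean μ g
      map_add' := by
        intro u v; ext c
        have := mean_add u v
        simp only [Pi.add_apply, Matrix.mulVec_add] at *
        change _ + mean μ (fun c => u c + v c) = _
        rw [this]; ring
      map_smul' := by
        intro t u; ext c
        have : mean μ (t • u) = t * mean μ u := by
          simp only [mean, Pi.smul_apply, smul_eq_mul, Finset.mul_sum]
          exact Finset.sum_congr rfl fun _ _ => by ring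
        simp only [this, Matrix.mulVec_smul, Pi.smul_apply, smul_eq_mul, RingHom.id_apply]
        ring }
  have hL : ∀ g, mean μ (L g) = mean μ g := by
    intro g
    change mean μ (fun c => (g c - Matrix.mulVec M g c) + mean μ g) = _
    rw [mean_add, mean_sub, mean_const]
    rw [mean_mulVec hinv]; ring
  have hinj : Function.Injective L := by
    rw [← LinearMap.ker_eq_bot, LinearMap.ker_eq_bot']
    intro g hg
    have h0 : mean μ g = 0 := by rw [← hL g, hg]; simp [mean]
    have h1 : Matrix.mulVec M g = g := by
      ext c
      have h2 : g c - Matrix.mulVec M g c + mean μ g = 0 := congrFun hg c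
      linarith
    ext c
    have h3 : g = fun _ => g c := by
      ext y; exact harmonic_const hM hirr h1 y c
    rw [h3, mean_const] at h0
    exact h0
  obtain ⟨g, hg⟩ := LinearMap.injective_iff_surjective.1 hinj f
  refine ⟨g, fun c => ?_⟩
  have h1 : g c - Matrix.mulVec M g c + mean μ g = f c := congrFun hg c
  have h2 := hL g
  rw [hg] at h2
  linarith

/-- Some state has positive mass, and by irreducibility a power of `M` moves part of it to `c`. -/
theorem invariant_pos (hirr : M.IsIrreducible)
    (hμ : μ ∈ stdSimplex ℝ S) (hinv : Matrix.vecMul μ M = μ) (c : S) : 0 < μ c := by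
  have key : ∀ k : ℕ, Matrix.vecMul μ (M ^ k) = μ := by
    intro k
    induction k with
    | zero => simp
    | succ k ih => rw [pow_succ, ← Matrix.vecMul_vecMul, ih, hinv]
  obtain ⟨x, hx⟩ : ∃ x, 0 < μ x := by
    by_contra! hcon
    have := Finset.sum_nonpos fun x (_ : x ∈ Finset.univ) => hcon x
    rw [hμ.2] at this
    linarith
  obtain ⟨k, -, hk⟩ := (Matrix.isIrreducible_iff_exists_pow_pos hirr.nonneg).1 hirr x c
  rw [← congrFun (key k) c]
  exact Finset.sum_pos' (fun y _ => mul_nonneg (hμ.1 y) (Matrix.pow_apply_nonneg hirr.nonneg k y c))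
    ⟨x, Finset.mem_univ x, mul_pos hx hk⟩

end Chain

/-! ### Second moments and the law of large numbers -/

section Chain

variable {S : Type*} [Fintype S] [DecidableEq S] [MeasurableSpace S] [MeasurableSingletonClass S]
  {Ω : Type*} [MeasurableSpace Ω] {Pr : Measure Ω} [IsProbabilityMeasure Pr]
  {C : ℕ → Ω → S} {M : Matrix S S ℝ} {μ : S → ℝ}

open Filter Topology

omit [MeasurableSingletonClass S] [IsProbabilityMeasure Pr] in
-- The Markov property in product form: the law of a path one step longer has exactly one more
-- factor.
theorem IsStationaryMarkovChain.path_step (hC : IsStationaryMarkovChain Pr C M μ) (n : ℕ)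
    (x : Fin (n + 1) → S) (s : S) :
    Pr.real {ω | (fun i : Fin (n + 1) => C i ω) = x ∧ C (n + 1) ω = s} =
      Pr.real {ω | (fun i : Fin (n + 1) => C i ω) = x} * M (x (Fin.last n)) s := by
  let c : ℕ → S := fun i => if hi : i < n + 1 then x ⟨i, hi⟩ else s
  have hc : ∀ i (hi : i < n + 1), c i = x ⟨i, hi⟩ := fun i hi => dif_pos hi
  have hcs : c (n + 1) = s := dif_neg (lt_irrefl _)
  have e1 : {ω | (fun i : Fin (n + 1) => C i ω) = x} = {ω | ∀ i ≤ n, C i ω = c i} := by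
    ext ω
    simp only [Set.mem_ofPred_eq, funext_iff, Fin.forall_iff]
    refine forall_congr' fun i => ⟨fun H hi => ?_, fun H hi => ?_⟩
    · rw [hc i (Nat.lt_succ_of_le hi)]; exact H _
    · rw [← hc i hi]; exact H (Nat.le_of_lt_succ hi)
  have e2 : {ω | (fun i : Fin (n + 1) => C i ω) = x ∧ C (n + 1) ω = s} =
      {ω | ∀ i ≤ n + 1, C i ω = c i} := by
    ext ω
    have := Set.ext_iff.1 e1 ω
    simp only [Set.mem_ofPred_eq] at this ⊢
    rw [this]
    constructor
    · rintro ⟨h1, h2⟩ i hi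
      rcases Nat.le_succ_iff.1 hi with h | rfl
      · exact h1 i h
      · rw [hcs]; exact h2
    · intro H
      exact ⟨fun i hi => H i (hi.trans (Nat.le_succ n)), (H _ le_rfl).trans hcs⟩
  rw [e1, e2, hC.law, hC.law, Finset.prod_range_succ, hcs, hc n (Nat.lt_succ_self n), mul_assoc]
  rfl

theorem integral_comp_finite {T : Type*} [Fintype T] [MeasurableSpace T]
    [MeasurableSingletonClass T] {X : Ω → T} (hX : Measurable X) (F : T → ℝ) :
    ∫ ω, F (X ω) ∂Pr = ∑ x, Pr.real {ω | X ω = x} * F x := by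
  have : IsProbabilityMeasure (Pr.map X) := Measure.isProbabilityMeasure_map hX.aemeasurable
  rw [← integral_map hX.aemeasurable (Measurable.of_discrete (f := F)).aestronglyMeasurable,
    integral_fintype .of_finite]
  refine Finset.sum_congr rfl fun x _ => ?_
  rw [smul_eq_mul, map_measureReal_apply hX (measurableSet_singleton x)]
  rfl

theorem integrable_comp_finite {T : Type*} [Finite T] [MeasurableSpace T]
    [MeasurableSingletonClass T] {X : Ω → T} (hX : Measurable X) (F : T → ℝ) :
    Integrable (fun ω => F (X ω)) Pr := by
  have : IsProbabilityMeasure (Pr.map X) := Measure.isProbabilityMeasure_map hX.aemeasurable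
  exact Integrable.comp_measurable .of_finite hX

omit [MeasurableSingletonClass S] [IsProbabilityMeasure Pr] in
theorem IsStationaryMarkovChain.measurable_path (hC : IsStationaryMarkovChain Pr C M μ) (n : ℕ) :
    Measurable fun ω => (fun i : Fin n => C i ω) :=
  measurable_pi_lambda _ fun i => hC.measurable i

/-- The increments `g (C (n + 1)) - (M g) (C n)` are orthogonal to the past. -/
theorem IsStationaryMarkovChain.integral_mul_increment (hC : IsStationaryMarkovChain Pr C M μ)
    (n : ℕ) (F : (Fin (n + 1) → S) → ℝ) (g : S → ℝ) :
    ∫ ω, F (fun i => C i ω) * (g (C (n + 1) ω) - Matrix.mulVec M g (C n ω)) ∂Pr = 0 := by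
  have hX := hC.measurable_path (n + 1)
  have hXY : Measurable fun ω => ((fun i : Fin (n + 1) => C i ω), C (n + 1) ω) :=
    hX.prodMk (hC.measurable (n + 1))
  have h1 := integral_comp_finite (Pr := Pr) hXY (fun p => F p.1 * g p.2)
  have h2 := integral_comp_finite (Pr := Pr) hX
    (fun x => F x * Matrix.mulVec M g (x (Fin.last n)))
  have i1 := integrable_comp_finite (Pr := Pr) hXY (fun p => F p.1 * g p.2)
  have i2 := integrable_comp_finite (Pr := Pr) hX
    (fun x => F x * Matrix.mulVec M g (x (Fin.last n)))
  simp only [Fin.val_last] at h1 h2 i1 i2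
  simp only [mul_sub]
  rw [integral_sub i1 i2, h1, h2, sub_eq_zero, Fintype.sum_prod_type]
  refine Finset.sum_congr rfl fun x _ => ?_
  -- By `path_step`, summing over the next state turns `g` into `M g` at the last state of the path.
  simp only [Prod.mk.injEq, hC.path_step, Matrix.mulVec, dotProduct, Finset.mul_sum]
  exact Finset.sum_congr rfl fun s _ => by ring

/-- The second moment of a sum of martingale increments grows at most linearly. -/
theorem IsStationaryMarkovChain.integral_sq_sum_increment_le
    (hC : IsStationaryMarkovChain Pr C M μ) (g : S → ℝ) {B : ℝ}
    (hB : ∀ s t, |g t - Matrix.mulVec M g s| ≤ B) (n : ℕ) :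
    ∫ ω, (∑ i ∈ Finset.range n, (g (C (i + 1) ω) - Matrix.mulVec M g (C i ω))) ^ 2 ∂Pr ≤
      n * B ^ 2 := by
  induction n with
  | zero => simp
  | succ n ih =>
    -- The earlier increments are a function of the path up to time `n`, so the cross term in the
    -- square has integral zero.
    let Q : (Fin (n + 1) → S) → ℝ := fun x =>
      ∑ i : Fin n, (g (x i.succ) - Matrix.mulVec M g (x i.castSucc))
    have hQ : ∀ ω, Q (fun i => C i ω) =
        ∑ i ∈ Finset.range n, (g (C (i + 1) ω) - Matrix.mulVec M g (C i ω)) := by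
      intro ω
      rw [Finset.sum_range]
      rfl
    have horth := hC.integral_mul_increment n Q g
    have hX := hC.measurable_path (n + 1)
    have hXY : Measurable fun ω => ((fun i : Fin (n + 1) => C i ω), C (n + 1) ω) :=
      hX.prodMk (hC.measurable (n + 1))
    have i1 := integrable_comp_finite (Pr := Pr) hX (fun x => Q x ^ 2)
    have i2 := integrable_comp_finite (Pr := Pr) hXY
      (fun p => Q p.1 * (g p.2 - Matrix.mulVec M g (p.1 (Fin.last n))))
    have i3 := integrable_comp_finite (Pr := Pr) hXY
      (fun p => (g p.2 - Matrix.mulVec M g (p.1 (Fin.last n))) ^ 2)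
    simp only [hQ, Fin.val_last] at horth i1 i2 i3
    have hexp : ∀ ω, (∑ i ∈ Finset.range (n + 1),
        (g (C (i + 1) ω) - Matrix.mulVec M g (C i ω))) ^ 2 =
        (∑ i ∈ Finset.range n, (g (C (i + 1) ω) - Matrix.mulVec M g (C i ω))) ^ 2 +
        (2 * ((∑ i ∈ Finset.range n, (g (C (i + 1) ω) - Matrix.mulVec M g (C i ω))) *
          (g (C (n + 1) ω) - Matrix.mulVec M g (C n ω))) +
        (g (C (n + 1) ω) - Matrix.mulVec M g (C n ω)) ^ 2) := by
      intro ω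
      rw [Finset.sum_range_succ]
      ring
    simp only [hexp]
    have i4 : Integrable (fun ω =>
        2 * ((∑ i ∈ Finset.range n, (g (C (i + 1) ω) - Matrix.mulVec M g (C i ω))) *
          (g (C (n + 1) ω) - Matrix.mulVec M g (C n ω))) +
        (g (C (n + 1) ω) - Matrix.mulVec M g (C n ω)) ^ 2) Pr := (i2.const_mul 2).add i3
    rw [integral_add i1 i4, integral_add (i2.const_mul 2) i3,
      integral_const_mul, horth]
    have h3 : ∫ ω, (g (C (n + 1) ω) - Matrix.mulVec M g (C n ω)) ^ 2 ∂Pr ≤ ∫ _, B ^ 2 ∂Pr := by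
      refine integral_mono i3 (integrable_const _) fun ω => ?_
      exact sq_le_sq' (neg_le_of_abs_le (hB _ _)) (le_of_abs_le (hB _ _))
    simp only [integral_const, probReal_univ, smul_eq_mul, one_mul] at h3
    push_cast
    linarith

/-- The second moment of the centred additive functional `∑ f (C i)` grows at most linearly. -/
theorem IsStationaryMarkovChain.exists_integral_sq_sum_le
    (hC : IsStationaryMarkovChain Pr C M μ) (f : S → ℝ) :
    ∃ K : ℝ, ∀ n : ℕ, 1 ≤ n →
      ∫ ω, (∑ i ∈ Finset.range n, (f (C i ω) - mean μ f)) ^ 2 ∂Pr ≤ K * n := by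
  obtain ⟨g, hg⟩ := exists_poisson hC.stochastic hC.irreducible hC.distribution hC.invariant f
  obtain ⟨B, hB⟩ : ∃ B, ∀ s t, |g t - Matrix.mulVec M g s| ≤ B := by
    obtain ⟨B, hB⟩ := (Set.finite_range
      fun p : S × S => |g p.2 - Matrix.mulVec M g p.1|).bddAbove
    exact ⟨B, fun s t => hB ⟨(s, t), rfl⟩⟩
  obtain ⟨G, hG⟩ : ∃ G, ∀ s t, |g s - g t| ≤ G := by
    obtain ⟨B, hB⟩ := (Set.finite_range fun p : S × S => |g p.1 - g p.2|).bddAbove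
    exact ⟨B, fun s t => hB ⟨(s, t), rfl⟩⟩
  -- `(x + y)² ≤ 2x² + 2y²`, with `x` the telescoped boundary term and `y` the martingale; `n ≥ 1`
  -- absorbs the constant `2 * G ^ 2`.
  refine ⟨2 * G ^ 2 + 2 * B ^ 2, fun n hn => ?_⟩
  have htel : ∀ ω, ∑ i ∈ Finset.range n, (f (C i ω) - mean μ f) =
      (g (C 0 ω) - g (C n ω)) +
        ∑ i ∈ Finset.range n, (g (C (i + 1) ω) - Matrix.mulVec M g (C i ω)) := by
    intro ω
    rw [← Finset.sum_range_sub' (fun i => g (C i ω)), ← Finset.sum_add_distrib]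
    refine Finset.sum_congr rfl fun i _ => ?_
    rw [← hg]
    ring
  have hX := hC.measurable_path (n + 1)
  have i1 : Integrable (fun ω => (∑ i ∈ Finset.range n, (f (C i ω) - mean μ f)) ^ 2) Pr := by
    simpa only [Finset.sum_range, Fin.val_castSucc, Fin.val_succ] using
      integrable_comp_finite (Pr := Pr) hX (fun x => (∑ i : Fin n, (f (x i.castSucc) - mean μ f)) ^ 2)
  have i2 : Integrable (fun ω =>
      (∑ i ∈ Finset.range n, (g (C (i + 1) ω) - Matrix.mulVec M g (C i ω))) ^ 2) Pr := by
    simpa only [Finset.sum_range, Fin.val_castSucc, Fin.val_succ] using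
      integrable_comp_finite (Pr := Pr) hX (fun x => (∑ i : Fin n, (g (x i.succ) - Matrix.mulVec M g (x i.castSucc))) ^ 2)
  calc ∫ ω, (∑ i ∈ Finset.range n, (f (C i ω) - mean μ f)) ^ 2 ∂Pr
      ≤ ∫ ω, (2 * G ^ 2 + 2 *
        (∑ i ∈ Finset.range n, (g (C (i + 1) ω) - Matrix.mulVec M g (C i ω))) ^ 2) ∂Pr := by
        refine integral_mono i1 ((integrable_const _).add (i2.const_mul 2)) fun ω => ?_
        simp only [htel ω]
        have h1 : (g (C 0 ω) - g (C n ω)) ^ 2 ≤ G ^ 2 :=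
          sq_le_sq' (neg_le_of_abs_le (hG _ _)) (le_of_abs_le (hG _ _))
        nlinarith [sq_nonneg ((g (C 0 ω) - g (C n ω)) -
          ∑ i ∈ Finset.range n, (g (C (i + 1) ω) - Matrix.mulVec M g (C i ω)))]
    _ ≤ 2 * G ^ 2 + 2 * (n * B ^ 2) := by
        rw [integral_add (integrable_const _) (i2.const_mul 2)]
        have := hC.integral_sq_sum_increment_le g hB n
        simp only [integral_const_mul, integral_const, probReal_univ, smul_eq_mul, one_mul]
        linarith
    _ ≤ (2 * G ^ 2 + 2 * B ^ 2) * n := by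
        have : (1 : ℝ) ≤ n := by exact_mod_cast hn
        nlinarith [sq_nonneg G, sq_nonneg B]

/-- Along the squares, the law of large numbers follows from Chebyshev and Borel–Cantelli. -/
theorem IsStationaryMarkovChain.ae_eventually_sq
    (hC : IsStationaryMarkovChain Pr C M μ) (f : S → ℝ) {η : ℝ} (hη : 0 < η) :
    ∀ᵐ ω ∂Pr, ∀ᶠ k : ℕ in atTop,
      |∑ i ∈ Finset.range (k ^ 2), (f (C i ω) - mean μ f)| < η * (k : ℝ) ^ 2 := by
  obtain ⟨K, hK⟩ := hC.exists_integral_sq_sum_le f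
  -- Chebyshev at time `(k + 1) ^ 2` gives a bound of order `1 / (k + 1) ^ 2`, which is summable.
  -- The shift avoids the zero threshold at time `0`.
  let s : ℕ → Set Ω := fun k => {ω | (η * ((k + 1 : ℕ) : ℝ) ^ 2) ^ 2 ≤
    (∑ i ∈ Finset.range ((k + 1) ^ 2), (f (C i ω) - mean μ f)) ^ 2}
  have hs : ∀ k, Pr.real (s k) ≤ K / η ^ 2 * (1 / ((k + 1 : ℕ) : ℝ) ^ 2) := by
    intro k
    have hX := hC.measurable_path ((k + 1) ^ 2)
    have i1 : Integrable (fun ω =>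
        (∑ i ∈ Finset.range ((k + 1) ^ 2), (f (C i ω) - mean μ f)) ^ 2) Pr := by
      simpa only [Finset.sum_range] using integrable_comp_finite (Pr := Pr) hX
        (fun x => (∑ i, (f (x i) - mean μ f)) ^ 2)
    have h1 := mul_meas_ge_le_integral_of_nonneg (μ := Pr)
      (ae_of_all _ fun ω => sq_nonneg (∑ i ∈ Finset.range ((k + 1) ^ 2), (f (C i ω) - mean μ f)))
      i1 ((η * ((k + 1 : ℕ) : ℝ) ^ 2) ^ 2)
    have h2 := h1.trans (hK ((k + 1) ^ 2) (Nat.one_le_pow _ _ k.succ_pos))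
    have h3 : (0 : ℝ) < ((k + 1 : ℕ) : ℝ) := by positivity
    change _ * Pr.real (s k) ≤ _ at h2
    push_cast at h2 h3 ⊢
    rw [div_mul_div_comm, le_div_iff₀ (by positivity), mul_one]
    have h4 : (Pr.real (s k) * (η ^ 2 * ((k : ℝ) + 1) ^ 2)) * ((k : ℝ) + 1) ^ 2 ≤
        K * ((k : ℝ) + 1) ^ 2 := by
      refine le_trans (le_of_eq ?_) h2
      ring
    exact le_of_mul_le_mul_right h4 (by positivity)
  have hsum : Summable fun k => Pr.real (s k) := by
    refine Summable.of_nonneg_of_le (fun k => measureReal_nonneg) hs ?_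
    exact ((summable_nat_add_iff 1).2
      (Real.summable_one_div_nat_pow.2 (by norm_num : 1 < 2))).mul_left _
  have hne : ∑' k, Pr (s k) ≠ ⊤ := by
    have h1 : ∀ k, Pr (s k) = ENNReal.ofReal (Pr.real (s k)) := fun k => by
      rw [ofReal_measureReal]
    simp only [h1]
    exact hsum.tsum_ofReal_ne_top
  filter_upwards [ae_eventually_notMem hne] with ω hω
  rw [← map_add_atTop_eq_nat 1, eventually_map]
  filter_upwards [hω] with k hk
  simp only [s, Set.mem_ofPred_eq, not_le] at hk
  exact abs_lt_of_sq_lt_sq hk (by positivity)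

/-- The law of large numbers for an irreducible stationary finite Markov chain. -/
theorem IsStationaryMarkovChain.ae_eventually_abs_sum_le
    (hC : IsStationaryMarkovChain Pr C M μ) (f : S → ℝ) {η : ℝ} (hη : 0 < η) :
    ∀ᵐ ω ∂Pr, ∀ᶠ r : ℕ in atTop,
      |∑ i ∈ Finset.range r, (f (C i ω) - mean μ f)| ≤ η * r := by
  obtain ⟨B, hB⟩ : ∃ B, ∀ s, |f s - mean μ f| ≤ B := by
    obtain ⟨B, hB⟩ := (Set.finite_range fun s => |f s - mean μ f|).bddAbove
    exact ⟨B, fun s => hB ⟨s, rfl⟩⟩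
  filter_upwards [hC.ae_eventually_sq f (half_pos hη)] with ω hω
  have hsqrt : Tendsto Nat.sqrt atTop atTop :=
    tendsto_atTop_atTop.2 fun b => ⟨b * b, fun a ha => Nat.le_sqrt.2 ha⟩
  -- Between consecutive squares at most `2 * sqrt r` terms remain; their sum is at most `η / 2 *
  -- (sqrt r) ^ 2` once `sqrt r ≥ 4 * B / η`.
  have hlarge : ∀ᶠ k : ℕ in atTop, 4 * B / η ≤ (k : ℝ) :=
    tendsto_natCast_atTop_atTop.eventually_ge_atTop _
  filter_upwards [hsqrt.eventually hω, hsqrt.eventually hlarge] with r h1 h2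
  have hle : Nat.sqrt r ^ 2 ≤ r := Nat.sqrt_le' r
  have hle2 : r ≤ Nat.sqrt r ^ 2 + 2 * Nat.sqrt r := by
    have := Nat.sqrt_le_add r
    nlinarith
  have h3 : |∑ i ∈ Finset.Ico (Nat.sqrt r ^ 2) r, (f (C i ω) - mean μ f)| ≤
      (2 * Nat.sqrt r : ℕ) * B := by
    have hB0 : 0 ≤ B := (abs_nonneg _).trans (hB (C 0 ω))
    refine (Finset.abs_sum_le_sum_abs _ _).trans ?_
    refine (Finset.sum_le_card_nsmul _ _ B fun i _ => hB _).trans ?_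
    rw [Nat.card_Ico, nsmul_eq_mul]
    refine mul_le_mul_of_nonneg_right ?_ hB0
    exact_mod_cast (by omega : r - Nat.sqrt r ^ 2 ≤ 2 * Nat.sqrt r)
  rw [← Finset.sum_range_add_sum_Ico _ hle]
  refine (abs_add_le _ _).trans ?_
  have h4 : ((Nat.sqrt r : ℝ)) ^ 2 ≤ r := by exact_mod_cast hle
  rw [div_le_iff₀ hη] at h2
  push_cast at h3
  have h5 : (0 : ℝ) ≤ Nat.sqrt r := Nat.cast_nonneg _
  nlinarith

/-- With probability close to one, the visit counts to all states are, from some deterministic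
time on, within a small relative error of their expectations. -/
theorem IsStationaryMarkovChain.exists_uniform_visits
    (hC : IsStationaryMarkovChain Pr C M μ) {η κ : ℝ} (hη : 0 < η) (hκ : 0 < κ) :
    ∃ (K : ℕ) (G : Set Ω), MeasurableSet G ∧ Pr.real Gᶜ ≤ κ ∧ ∀ ω ∈ G, ∀ r ≥ K, ∀ s,
      |(∑ i ∈ Finset.range r, if C i ω = s then (1 : ℝ) else 0) - μ s * r| ≤ η * (μ s * r) := by
  have hpos := invariant_pos hC.irreducible hC.distribution hC.invariant
  let E : ℕ → Set Ω := fun r => ⋂ s, {ω |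
    |(∑ i ∈ Finset.range r, if C i ω = s then (1 : ℝ) else 0) - μ s * r| ≤ η * (μ s * r)}
  have hE : ∀ r, MeasurableSet (E r) := by
    intro r
    refine MeasurableSet.iInter fun s => measurableSet_le ?_ measurable_const
    refine Measurable.abs (Measurable.sub_const (Finset.measurable_sum _ fun i _ => ?_) _)
    exact Measurable.ite (hC.measurable i (measurableSet_singleton s)) measurable_const
      measurable_const
  -- These events increase with `K` and exhaust almost all outcomes, so one of them has probability
  -- at least `1 - κ`.
  let G : ℕ → Set Ω := fun K => ⋂ r ≥ K, E r
  have hG : ∀ K, MeasurableSet (G K) := fun K =>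
    MeasurableSet.iInter fun r => MeasurableSet.iInter fun _ => hE r
  have hmono : Monotone G := fun K L hKL =>
    Set.iInter₂_mono' fun r hr => ⟨r, le_trans hKL hr, subset_rfl⟩
  have hae : ∀ᵐ ω ∂Pr, ω ∈ ⋃ K, G K := by
    have h1 : ∀ s, ∀ᵐ ω ∂Pr, ∀ᶠ r : ℕ in atTop,
        |(∑ i ∈ Finset.range r, if C i ω = s then (1 : ℝ) else 0) - μ s * r| ≤
          η * (μ s * r) := by
      intro s
      filter_upwards [hC.ae_eventually_abs_sum_le (fun c => if c = s then 1 else 0)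
        (mul_pos hη (hpos s))] with ω hω
      filter_upwards [hω] with r hr
      have : mean μ (fun c => if c = s then 1 else 0) = μ s := by simp [mean]
      rw [this, Finset.sum_sub_distrib, Finset.sum_const, Finset.card_range, nsmul_eq_mul] at hr
      rw [mul_comm (μ s) (r : ℝ)]
      refine hr.trans (le_of_eq ?_)
      ring
    filter_upwards [ae_all_iff.2 h1] with ω hω
    obtain ⟨K, hK⟩ := eventually_atTop.1 (eventually_all.2 hω)
    exact Set.mem_iUnion.2 ⟨K, Set.mem_iInter₂.2 fun r hr => Set.mem_iInter.2 fun s => hK r hr s⟩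
  have hlim := tendsto_measure_iUnion_atTop (μ := Pr) hmono
  have hone : Pr (⋃ K, G K) = 1 := by
    rw [← measure_univ (μ := Pr)]
    exact measure_congr (eventuallyEq_univ.2 hae)
  rw [hone] at hlim
  have hlim' := (ENNReal.tendsto_toReal ENNReal.one_ne_top).comp hlim
  rw [ENNReal.toReal_one] at hlim'
  obtain ⟨K, hK⟩ := (hlim'.eventually_const_le (show 1 - κ < 1 by linarith)).exists
  refine ⟨K, G K, hG K, ?_, fun ω hω r hr s => ?_⟩
  · rw [probReal_compl_eq_one_sub (hG K)]
    change 1 - κ ≤ Pr.real (G K) at hK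
    linarith
  · exact Set.mem_iInter.1 (Set.mem_iInter₂.1 hω r hr) s

end Chain

/-! ### Deterministic estimates for the stopping round on one path -/

section Path

variable {S : Type*} {c : ℕ → S} {a : S → ℝ} {R : ℕ}

/-- At the stopping round, `R * A ≤ ∑ a < R * R`. -/
theorem lt_stop (hR : IsLeast {r : ℕ | 1 ≤ r ∧ ∑ i ∈ Finset.range r, a (c i) < (r : ℝ) * r} R)
    {A : ℝ} (hA : ∀ s, A ≤ a s) : A < R := by
  obtain ⟨⟨h1, h2⟩, -⟩ := hR
  have h3 : (R : ℝ) * A ≤ ∑ i ∈ Finset.range R, a (c i) := by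
    simpa using Finset.card_nsmul_le_sum (Finset.range R) (fun i => a (c i)) A fun i _ => hA _
  have h4 : (0 : ℝ) < R := by exact_mod_cast h1
  exact lt_of_mul_lt_mul_left (h3.trans_lt h2) h4.le

/-- The criterion fails at `R - 1`, so `(R - 1)² ≤ (R - 1) * B`. The case `R = 1` is separate
because round `0` is never tested. -/
theorem stop_le (hR : IsLeast {r : ℕ | 1 ≤ r ∧ ∑ i ∈ Finset.range r, a (c i) < (r : ℝ) * r} R)
    {B : ℝ} (hB0 : 0 ≤ B) (hB : 2 ≤ R → ∑ i ∈ Finset.range (R - 1), a (c i) ≤ (R - 1 : ℕ) * B) :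
    (R : ℝ) ≤ B + 1 := by
  rcases Nat.lt_or_ge R 2 with h2 | h2
  · have : (R : ℝ) ≤ 1 := by exact_mod_cast Nat.le_of_lt_succ h2
    linarith
  · by_contra! hcon
    have hcast : ((R - 1 : ℕ) : ℝ) = R - 1 := by
      rw [Nat.cast_sub (by omega), Nat.cast_one]
    have hpos : (0 : ℝ) < ((R - 1 : ℕ) : ℝ) := by exact_mod_cast (by omega : 0 < R - 1)
    have h3 := hR.2 (show R - 1 ∈ {r : ℕ | 1 ≤ r ∧ ∑ i ∈ Finset.range r, a (c i) < (r : ℝ) * r} from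
      ⟨by omega, (hB h2).trans_lt (mul_lt_mul_of_pos_left (by rw [hcast]; linarith) hpos)⟩)
    omega

theorem exists_stop [Finite S] (c : ℕ → S) (a : S → ℝ) :
    ∃ r : ℕ, 1 ≤ r ∧ ∑ i ∈ Finset.range r, a (c i) < (r : ℝ) * r := by
  obtain ⟨B, hB⟩ := (Set.finite_range a).bddAbove
  obtain ⟨r, hr⟩ := exists_nat_gt B
  refine ⟨r + 1, by omega, ?_⟩
  have h1 : ∑ i ∈ Finset.range (r + 1), a (c i) ≤ ((r + 1 : ℕ) : ℝ) * B := by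
    simpa using Finset.sum_le_card_nsmul (Finset.range (r + 1)) (fun i => a (c i)) B
      fun i _ => hB ⟨c i, rfl⟩
  refine h1.trans_lt (mul_lt_mul_of_pos_left ?_ (by positivity))
  push_cast
  linarith

variable [Fintype S] [DecidableEq S] {μ : S → ℝ} {η : ℝ}

/-- Group the sum by states: the relative error is the same for all of them and the weights `b s`
are nonnegative, so `η` does not depend on `b`. Uniformity in the policy rests on this. -/
theorem abs_sum_sub_mean_le {r : ℕ} (hc : ∀ s,
      |(∑ i ∈ Finset.range r, if c i = s then (1 : ℝ) else 0) - μ s * r| ≤ η * (μ s * r))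
    {b : S → ℝ} (hb : ∀ s, 0 ≤ b s) :
    |∑ i ∈ Finset.range r, b (c i) - r * mean μ b| ≤ η * (r * mean μ b) := by
  have h1 : ∑ i ∈ Finset.range r, b (c i) =
      ∑ s, b s * ∑ i ∈ Finset.range r, if c i = s then (1 : ℝ) else 0 := by
    simp only [Finset.mul_sum]
    rw [Finset.sum_comm]
    refine Finset.sum_congr rfl fun i _ => ?_
    simp
  have h2 : r * mean μ b = ∑ s, b s * (μ s * r) := by
    rw [mean, Finset.mul_sum]
    exact Finset.sum_congr rfl fun s _ => by ring
  rw [h1, h2, ← Finset.sum_sub_distrib, Finset.mul_sum]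
  refine (Finset.abs_sum_le_sum_abs _ _).trans (Finset.sum_le_sum fun s _ => ?_)
  rw [← mul_sub, abs_mul, abs_of_nonneg (hb s)]
  have := mul_le_mul_of_nonneg_left (hc s) (hb s)
  linarith

/-- On a path whose visit counts are close to their expectations, the total duration up to the
stopping time is close to the product of the means. -/
theorem sum_duration_bounds
    (hR : IsLeast {r : ℕ | 1 ≤ r ∧ ∑ i ∈ Finset.range r, a (c i) < (r : ℝ) * r} R)
    (hη : 0 < η) (hη1 : η ≤ 1) {K : ℕ} (hc : ∀ r ≥ K, ∀ s,
      |(∑ i ∈ Finset.range r, if c i = s then (1 : ℝ) else 0) - μ s * r| ≤ η * (μ s * r))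
    (ha : ∀ s, (K : ℝ) ≤ a s) (hmean : 1 ≤ η * mean μ a)
    {b : S → ℝ} (hb : ∀ s, 0 ≤ b s) (hbm : 0 ≤ mean μ b) :
    (1 - η) ^ 2 * (mean μ a * mean μ b) ≤ ∑ i ∈ Finset.range R, b (c i) ∧
      ∑ i ∈ Finset.range R, b (c i) ≤ (1 + η) * (1 + 2 * η) * (mean μ a * mean μ b) := by
  have ha0 : ∀ s, 0 ≤ a s := fun s => (Nat.cast_nonneg K).trans (ha s)
  -- Strictness matters: the visit estimate is needed at `R - 1` as well as at `R`.
  have hKR : K < R := by exact_mod_cast lt_stop hR ha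
  have hR0 : (0 : ℝ) < R := by exact_mod_cast (Nat.zero_le K).trans_lt hKR
  have hmean0 : 0 < mean μ a := pos_of_mul_pos_right (one_pos.trans_le hmean) hη.le
  have h1 := abs_le.1 (abs_sum_sub_mean_le (hc R hKR.le) ha0)
  have h2 : (1 - η) * mean μ a < R := by
    refine lt_of_mul_lt_mul_left (a := (R : ℝ)) ?_ hR0.le
    have := hR.1.2
    nlinarith
  have h3 : (R : ℝ) ≤ (1 + η) * mean μ a + 1 := by
    refine stop_le hR (by positivity) fun _ => ?_
    have := abs_le.1 (abs_sum_sub_mean_le (hc (R - 1) (Nat.le_sub_one_of_lt hKR)) ha0)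
    linarith
  have h4 := abs_le.1 (abs_sum_sub_mean_le (hc R hKR.le) hb)
  constructor
  · calc (1 - η) ^ 2 * (mean μ a * mean μ b)
        = (1 - η) * mean μ b * ((1 - η) * mean μ a) := by ring
      _ ≤ (1 - η) * mean μ b * R :=
        mul_le_mul_of_nonneg_left h2.le (mul_nonneg (by linarith) hbm)
      _ ≤ _ := by linarith
  -- The surplus `1` in `h3` is at most `η * mean μ a`, whence the factor `1 + 2 * η`.
  · calc ∑ i ∈ Finset.range R, b (c i) ≤ (1 + η) * mean μ b * R := by linarith
      _ ≤ (1 + η) * mean μ b * ((1 + 2 * η) * mean μ a) :=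
        mul_le_mul_of_nonneg_left (by linarith) (mul_nonneg (by linarith) hbm)
      _ = _ := by ring

omit [DecidableEq S] in
-- One term of the mean already has weight at least `κ`.
theorem le_mean_div {κ : ℝ} (hκ : 0 < κ) (hμ : ∀ s, κ ≤ μ s) {b : S → ℝ} (hb : ∀ s, 0 ≤ b s)
    (s : S) : b s ≤ mean μ b / κ := by
  rw [le_div_iff₀ hκ]
  calc b s * κ ≤ μ s * b s := by
        rw [mul_comm]; exact mul_le_mul_of_nonneg_right (hμ s) (hb s)
    _ ≤ mean μ b := Finset.single_le_sum (f := fun s => μ s * b s)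
        (fun t _ => mul_nonneg (hκ.le.trans (hμ t)) (hb t)) (Finset.mem_univ s)

omit [DecidableEq S] in
/-- On every path, the total duration up to the stopping time is at most a constant multiple of the
product of the means. -/
theorem sum_duration_le
    (hR : IsLeast {r : ℕ | 1 ≤ r ∧ ∑ i ∈ Finset.range r, a (c i) < (r : ℝ) * r} R)
    {κ : ℝ} (hκ : 0 < κ) (hκ1 : κ ≤ 1) (hμ : ∀ s, κ ≤ μ s) (ha : ∀ s, 0 ≤ a s)
    (hmean : 1 ≤ mean μ a) {b : S → ℝ} (hb : ∀ s, 0 ≤ b s) (hbm : 0 ≤ mean μ b) :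
    ∑ i ∈ Finset.range R, b (c i) ≤ 2 / κ ^ 2 * (mean μ a * mean μ b) := by
  -- One factor `1 / κ` comes from `R`, the other from `b`; the `2` absorbs the extra round.
  have h1 : (R : ℝ) ≤ mean μ a / κ + 1 := by
    refine stop_le hR (by positivity) fun _ => ?_
    simpa using Finset.sum_le_card_nsmul (Finset.range (R - 1)) (fun i => a (c i)) (mean μ a / κ)
      fun i _ => le_mean_div hκ hμ ha _
  have h2 : 1 ≤ mean μ a / κ := by
    rw [le_div_iff₀ hκ]; linarith
  calc ∑ i ∈ Finset.range R, b (c i) ≤ R * (mean μ b / κ) := by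
        simpa using Finset.sum_le_card_nsmul (Finset.range R) (fun i => b (c i)) (mean μ b / κ)
          fun i _ => le_mean_div hκ hμ hb _
    _ ≤ (2 * (mean μ a / κ)) * (mean μ b / κ) :=
        mul_le_mul_of_nonneg_right (by linarith) (by positivity)
    _ = _ := by field_simp

end Path

/-! ### Measurability of stopped sums -/

section Measurability

variable {S : Type*} [Finite S] [MeasurableSpace S] [MeasurableSingletonClass S]
  {Ω : Type*} [MeasurableSpace Ω]

/-- `R` is the first index of a sequence of measurable events, and the stopped sum is pieced
together over its countably many values. -/
theorem measurable_sum_stop {C : ℕ → Ω → S} (hC : ∀ n, Measurable (C n)) (a b : S → ℝ)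
    {R : Ω → ℕ} (hR : ∀ ω, IsLeast {r : ℕ | 1 ≤ r ∧
      ∑ i ∈ Finset.range r, a (C i ω) < (r : ℝ) * r} (R ω)) :
    Measurable fun ω => ∑ i ∈ Finset.range (R ω), b (C i ω) := by
  classical
  have hsum : ∀ (f : S → ℝ) (r : ℕ), Measurable fun ω => ∑ i ∈ Finset.range r, f (C i ω) :=
    fun f r => Finset.measurable_sum _ fun i _ => (Measurable.of_discrete (f := f)).comp (hC i)
  have hex : ∀ ω, ∃ r : ℕ, 1 ≤ r ∧ ∑ i ∈ Finset.range r, a (C i ω) < (r : ℝ) * r :=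
    fun ω => ⟨R ω, (hR ω).1⟩
  have hRm : Measurable R := by
    have h1 : R = fun ω => Nat.find (hex ω) := by
      ext ω
      exact le_antisymm ((hR ω).2 (Nat.find_spec (hex ω))) (Nat.find_min' (hex ω) (hR ω).1)
    rw [h1]
    refine measurable_find hex fun r => ?_
    exact (MeasurableSet.const _).inter (measurableSet_lt (hsum a r) measurable_const)
  exact (measurable_from_prod_countable_right (f := fun p : ℕ × Ω =>
    ∑ i ∈ Finset.range p.1, b (C i p.2)) fun r => hsum b r).comp (hRm.prodMk measurable_id)

end Measurability

/-! ### Uniform growth of the rates -/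

open Filter Topology

/-- A norm on `ℝ^m` is equivalent to the supremum norm. -/
theorem IsNorm.equiv_sup {m : ℕ} {N : Seminorm ℝ (Fin m → ℝ)} (hN : IsNorm N) :
    ∃ k K : ℝ, 0 < k ∧ 0 < K ∧ ∀ x, k * ‖x‖ ≤ N x ∧ N x ≤ K * ‖x‖ := by
  -- The summand `1` keeps the constant positive when `m = 0`.
  have hK : ∀ x, N x ≤ (∑ i, N (Pi.single i 1) + 1) * ‖x‖ := by
    intro x
    have h1 : N x ≤ ∑ i, N (x i • Pi.single i (1 : ℝ)) := by
      have h0 : x = ∑ i, x i • Pi.single i (1 : ℝ) := by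
        ext j
        simp [Pi.single_apply]
      conv_lhs => rw [h0]
      exact Finset.le_sum_of_subadditive N (map_zero N).le (map_add_le_add N) Finset.univ _
    have h2 : ∑ i, N (x i • Pi.single i (1 : ℝ)) ≤ ∑ i, N (Pi.single i 1) * ‖x‖ := by
      refine Finset.sum_le_sum fun i _ => ?_
      rw [map_smul_eq_mul, mul_comm]
      exact mul_le_mul_of_nonneg_left (norm_le_pi_norm x i) (apply_nonneg N _)
    rw [← Finset.sum_mul] at h2
    nlinarith [norm_nonneg x]
  have hKpos : 0 < ∑ i, N (Pi.single i 1) + 1 :=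
    add_pos_of_nonneg_of_pos (Finset.sum_nonneg fun i _ => apply_nonneg N _) one_pos
  have hcont : Continuous N := by
    refine Seminorm.continuous_of_le (q := (∑ i, N (Pi.single i 1) + 1).toNNReal •
      normSeminorm ℝ (Fin m → ℝ)) ?_ ?_
    · change Continuous fun x : Fin m → ℝ => (∑ i, N (Pi.single i 1) + 1).toNNReal • ‖x‖
      fun_prop
    · intro x
      refine (hK x).trans (le_of_eq ?_)
      change _ = ((∑ i, N (Pi.single i 1) + 1).toNNReal : ℝ) * ‖x‖
      rw [Real.coe_toNNReal _ hKpos.le]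
  obtain ⟨k, hk, hkN⟩ : ∃ k > 0, ∀ x : Fin m → ℝ, ‖x‖ = 1 → k ≤ N x := by
    by_cases hne : (Metric.sphere (0 : Fin m → ℝ) 1).Nonempty
    · obtain ⟨x, hx, hmin⟩ := (isCompact_sphere (0 : Fin m → ℝ) 1).exists_isMinOn hne
        hcont.continuousOn
      refine ⟨N x, lt_of_le_of_ne (apply_nonneg N x) ?_, fun y hy => hmin (by simpa using hy)⟩
      intro h0
      have := hN x h0.symm
      rw [this] at hx
      simp at hx
    · exact ⟨1, one_pos, fun x hx => absurd ⟨x, by simpa using hx⟩ hne⟩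
  refine ⟨k, _, hk, hKpos, fun x => ⟨?_, hK x⟩⟩
  rcases eq_or_ne x 0 with rfl | hx
  · simp
  · have hx' : 0 < ‖x‖ := norm_pos_iff.2 hx
    have h1 := hkN (‖x‖⁻¹ • x) (by rw [norm_smul, norm_inv, norm_norm, inv_mul_cancel₀ hx'.ne'])
    rw [map_smul_eq_mul, norm_inv, norm_norm, inv_mul_eq_div, le_div_iff₀ hx'] at h1
    exact h1

/-- Under a compression vector that is used in every round, the number of rounds is at most the
rate of that vector plus two. -/
theorem minRounds_const_le {m : ℕ} {qmax : ℝ} {reached : Convergence m qmax}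
    {h : ℝ → Set.Icc (0 : ℝ) qmax → ℝ} {N : Seminorm ℝ (Fin m → ℝ)}
    (hR : RoundsCriterion reached h N) {ε : ℝ} (hε : 0 < ε) (q : CompVec m qmax) :
    (minRounds reached ε (fun _ => q) : ℝ) ≤ N (vecH (h ε) q) + 2 := by
  have h0 : 0 ≤ N (vecH (h ε) q) := apply_nonneg N _
  have hmem : ⌊N (vecH (h ε) q)⌋₊ + 1 ∈ {r : ℕ | 1 ≤ r ∧ reached ε (fun _ => q) r} := by
    refine ⟨by simp, (hR.reached_iff ε hε _ _ (by simp)).2 ?_⟩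
    have h1 := Nat.lt_floor_add_one (N (vecH (h ε) q))
    have h2 : (0 : ℝ) < (⌊N (vecH (h ε) q)⌋₊ : ℝ) + 1 := by positivity
    simp only [Finset.sum_const, Finset.card_range, nsmul_eq_mul, Nat.cast_add, Nat.cast_one]
    rw [← mul_assoc, one_div, inv_mul_cancel₀ h2.ne', one_mul]
    exact h1
  have h3 : (minRounds reached ε (fun _ => q) : ℝ) ≤ (⌊N (vecH (h ε) q)⌋₊ + 1 : ℕ) := by
    exact_mod_cast Nat.sInf_le hmem
  have h4 := Nat.floor_le h0
  push_cast at h3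
  linarith

/-- The number of rounds grows beyond all bounds as the tolerance tends to `0`. -/
theorem RoundsGrowth.tendsto {m : ℕ} {qmax : ℝ} {reached : Convergence m qmax}
    (hG : RoundsGrowth reached) (q : CompSeq m qmax) :
    Tendsto (fun ε : ℝ => (minRounds reached ε q : ℝ)) (𝓝[>] 0) atTop := by
  obtain ⟨p, hp, hp0, hθ⟩ := hG q
  have h1 : Tendsto (fun ε : ℝ => p.eval ε) (𝓝[>] 0) (𝓝[≠] 0) := by
    refine tendsto_nhdsWithin_iff.2 ⟨?_, ?_⟩
    · have := (p.continuous.tendsto 0).mono_left (nhdsWithin_le_nhds (s := Set.Ioi (0 : ℝ)))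
      rwa [hp0] at this
    · have hfin : {x | p.IsRoot x}.Finite := Polynomial.finite_setOfPred_isRoot hp
      have h2 : ∀ᶠ x in 𝓝[≠] (0 : ℝ), x ∉ {x | p.IsRoot x} := by
        -- The finitely many nonzero roots of `p` stay away from `0`.
        have h3 : ({x | p.IsRoot x} \ {0})ᶜ ∈ 𝓝 (0 : ℝ) :=
          (hfin.subset Set.sdiff_subset).isClosed.isOpen_compl.mem_nhds (by simp)
        filter_upwards [mem_nhdsWithin_of_mem_nhds h3, self_mem_nhdsWithin] with x hx hx0 hr
        exact hx ⟨hr, hx0⟩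
      exact h2.filter_mono (nhdsWithin_mono 0 fun x hx => ne_of_gt hx)
  have h2 : Tendsto (fun ε : ℝ => ‖1 / p.eval ε‖) (𝓝[>] 0) atTop := by
    have := tendsto_norm_inv_nhdsNE_zero_atTop.comp h1
    simpa [Function.comp_def] using this
  have h3 := (hθ.tendsto_norm_atTop_iff).2 h2
  simpa [Function.comp_def] using h3

/-- As the tolerance tends to `0`, the rates of all compression vectors grow uniformly. -/
theorem rate_large {m : ℕ} {qmax : ℝ} (hqmax : 0 ≤ qmax) {reached : Convergence m qmax}
    {h : ℝ → Set.Icc (0 : ℝ) qmax → ℝ} {N : Seminorm ℝ (Fin m → ℝ)}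
    (hR : RoundsCriterion reached h N) (hG : RoundsGrowth reached) (A : ℝ) :
    ∃ εth > 0, ∀ ε, 0 < ε → ε < εth → ∀ q : CompVec m qmax, A < N (vecH (h ε) q) := by
  obtain ⟨k, K, hk, hK, hkK⟩ := hR.isNorm.equiv_sup
  let z : CompVec m qmax := fun _ => ⟨0, le_refl 0, hqmax⟩
  -- Growth is known only for each sequence separately. The constant zero vector suffices, since `h
  -- ε` is smallest there; `K / k` pays for comparing norms and `2` for `minRounds_const_le`.
  have hev := (hG.tendsto (fun _ => z)).eventually_gt_atTop (K / k * |A| + 2)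
  rw [eventually_nhdsWithin_iff, Metric.eventually_nhds_iff] at hev
  obtain ⟨e, he, hev⟩ := hev
  refine ⟨e, he, fun ε hε hεe q => ?_⟩
  have h1 := hev (y := ε) (by simpa [abs_of_pos hε] using hεe) hε
  have h2 := minRounds_const_le hR hε z
  have h3 : K / k * |A| < N (vecH (h ε) z) := by linarith
  have h4 : ‖vecH (h ε) z‖ ≤ ‖vecH (h ε) q‖ := by
    refine (pi_norm_le_iff_of_nonneg (norm_nonneg _)).2 fun j => ?_
    refine le_trans ?_ (norm_le_pi_norm (vecH (h ε) q) j)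
    change |h ε (z j)| ≤ |h ε (q j)|
    rw [abs_of_nonneg (hR.nonneg ε hε _), abs_of_nonneg (hR.nonneg ε hε _)]
    exact (hR.strictMono ε hε).monotone (Subtype.mk_le_mk.2 (q j).2.1)
  have h5 := (hkK (vecH (h ε) z)).2
  have h6 := (hkK (vecH (h ε) q)).1
  have h7 : K * (|A|) < K * (k * ‖vecH (h ε) z‖) := by
    rw [div_mul_eq_mul_div, div_lt_iff₀ hk] at h3
    nlinarith
  have h8 := lt_of_mul_lt_mul_left h7 hK.le
  nlinarith [le_abs_self A]

/-! ### Means and the expected stopped sum -/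

theorem exists_pos_le_of_forall_pos {S : Type*} [Finite S] {μ : S → ℝ} (hμ : ∀ s, 0 < μ s) :
    ∃ κ > 0, κ ≤ 1 ∧ ∀ s, κ ≤ μ s := by
  rcases isEmpty_or_nonempty S with hS | hS
  · exact ⟨1, one_pos, le_rfl, fun s => hS.elim s⟩
  · obtain ⟨s, hs⟩ := Finite.exists_min μ
    exact ⟨min 1 (μ s), lt_min one_pos (hμ s), min_le_left _ _,
      fun t => (min_le_right _ _).trans (hs t)⟩

theorem le_mean {S : Type*} [Fintype S] {μ : S → ℝ} (hμ : μ ∈ stdSimplex ℝ S) {b : S → ℝ} {x : ℝ}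
    (hb : ∀ s, x ≤ b s) : x ≤ mean μ b := by
  calc x = ∑ s, μ s * x := by rw [← Finset.sum_mul, hμ.2, one_mul]
    _ ≤ mean μ b := Finset.sum_le_sum fun s _ => mul_le_mul_of_nonneg_left (hb s) (hμ.1 s)

theorem mean_pos {S : Type*} [Fintype S] {μ : S → ℝ} (hμ : μ ∈ stdSimplex ℝ S) {b : S → ℝ}
    (hb : ∀ s, 0 < b s) : 0 < mean μ b := by
  obtain ⟨κ, hκ, -, hκb⟩ := exists_pos_le_of_forall_pos hb
  exact hκ.trans_le (le_mean hμ hκb)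

theorem RoundsCriterion.setOf_reached {m : ℕ} {qmax : ℝ} {reached : Convergence m qmax}
    {h : ℝ → Set.Icc (0 : ℝ) qmax → ℝ} {N : Seminorm ℝ (Fin m → ℝ)}
    (hR : RoundsCriterion reached h N) {ε : ℝ} (hε : 0 < ε) (q : CompSeq m qmax) :
    {r : ℕ | 1 ≤ r ∧ reached ε q r} =
      {r : ℕ | 1 ≤ r ∧ ∑ n ∈ Finset.range r, N (vecH (h ε) (q n)) < (r : ℝ) * r} := by
  ext r
  refine and_congr_right fun hr => ?_
  have hr0 : (0 : ℝ) < r := by exact_mod_cast hr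
  rw [hR.reached_iff ε hε q r hr, gt_iff_lt, one_div, inv_mul_lt_iff₀ hr0]

/-- The expected value of the total duration up to the stopping time, for uniformly large rates. -/
theorem IsStationaryMarkovChain.integral_sum_stop_bounds
    {S : Type*} [Fintype S] [DecidableEq S] [MeasurableSpace S] [MeasurableSingletonClass S]
    {Ω : Type*} [MeasurableSpace Ω] {Pr : Measure Ω} [IsProbabilityMeasure Pr]
    {C : ℕ → Ω → S} {M : Matrix S S ℝ} {μ : S → ℝ} (hC : IsStationaryMarkovChain Pr C M μ)
    {δ : ℝ} (hδ : 0 < δ) :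
    ∃ A : ℝ, 0 < A ∧ ∀ a b : S → ℝ, (∀ s, A ≤ a s) → (∀ s, 0 < b s) → ∀ R : Ω → ℕ,
      (∀ ω, IsLeast {r : ℕ | 1 ≤ r ∧ ∑ i ∈ Finset.range r, a (C i ω) < (r : ℝ) * r} (R ω)) →
      Integrable (fun ω => ∑ i ∈ Finset.range (R ω), b (C i ω)) Pr ∧
      (1 - δ) * (mean μ a * mean μ b) ≤ ∫ ω, ∑ i ∈ Finset.range (R ω), b (C i ω) ∂Pr ∧
      ∫ ω, ∑ i ∈ Finset.range (R ω), b (C i ω) ∂Pr ≤ (1 + δ) * (mean μ a * mean μ b) := by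
  obtain ⟨κ, hκ, hκ1, hκμ⟩ := exists_pos_le_of_forall_pos
    (invariant_pos hC.irreducible hC.distribution hC.invariant)
  -- Since `η ≤ 1`, `(1 + η) * (1 + 2 * η) + η ≤ 1 + 6 * η`.
  obtain ⟨η, hη, hη1, hηδ⟩ : ∃ η : ℝ, 0 < η ∧ η ≤ 1 ∧ 6 * η ≤ δ :=
    ⟨min 1 (δ / 6), lt_min one_pos (by positivity), min_le_left _ _, by
      linarith [min_le_right 1 (δ / 6)]⟩
  -- This bound on the bad event cancels the constant `2 / κ ^ 2`, leaving `η * P`.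
  have hθ : 0 < η * (κ ^ 2 / 2) := by positivity
  obtain ⟨K, G, hG, hGc, hK⟩ := hC.exists_uniform_visits hη hθ
  -- `K` delays stopping until the visit estimates hold; `1 / η` makes one round negligible against
  -- `mean μ a`.
  refine ⟨max K (1 / η), lt_max_of_lt_right (by positivity), fun a b ha hb R hR => ?_⟩
  have haK : ∀ s, (K : ℝ) ≤ a s := fun s => (le_max_left _ _).trans (ha s)
  have ha1 : 1 / η ≤ mean μ a := (le_max_right _ _).trans (le_mean hC.distribution ha)
  have hmean : 1 ≤ η * mean μ a := by rwa [div_le_iff₀' hη] at ha1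
  have hmean0 : 0 < mean μ a := pos_of_mul_pos_right (one_pos.trans_le hmean) hη.le
  have hmean1 : 1 ≤ mean μ a := hmean.trans (mul_le_of_le_one_left hmean0.le hη1)
  have hbm := mean_pos hC.distribution hb
  have hP : 0 < mean μ a * mean μ b := mul_pos hmean0 hbm
  set P := mean μ a * mean μ b with hPdef
  have hgood : ∀ ω ∈ G, (1 - η) ^ 2 * P ≤ ∑ i ∈ Finset.range (R ω), b (C i ω) ∧
      ∑ i ∈ Finset.range (R ω), b (C i ω) ≤ (1 + η) * (1 + 2 * η) * P := fun ω hω =>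
    sum_duration_bounds (hR ω) hη hη1 (hK ω hω) haK hmean (fun s => (hb s).le) hbm.le
  have hbad : ∀ ω, ∑ i ∈ Finset.range (R ω), b (C i ω) ≤ 2 / κ ^ 2 * P := fun ω =>
    sum_duration_le (hR ω) hκ hκ1 hκμ (fun s => (Nat.cast_nonneg K).trans (haK s)) hmean1
      (fun s => (hb s).le) hbm.le
  have hnonneg : ∀ ω, 0 ≤ ∑ i ∈ Finset.range (R ω), b (C i ω) := fun ω =>
    Finset.sum_nonneg fun i _ => (hb _).le
  have hint : Integrable (fun ω => ∑ i ∈ Finset.range (R ω), b (C i ω)) Pr := by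
    refine Integrable.of_bound
      (measurable_sum_stop hC.measurable a b hR).aestronglyMeasurable (2 / κ ^ 2 * P)
      (ae_of_all _ fun ω => ?_)
    rw [Real.norm_of_nonneg (hnonneg ω)]
    exact hbad ω
  have hGreal : Pr.real G = 1 - Pr.real Gᶜ := by
    rw [probReal_compl_eq_one_sub hG]; ring
  have hGc0 : 0 ≤ Pr.real Gᶜ := measureReal_nonneg
  have hG1 : Pr.real G ≤ 1 := by linarith
  have hθη : η * (κ ^ 2 / 2) ≤ η := by
    have : κ ^ 2 ≤ 1 := pow_le_one₀ hκ.le hκ1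
    nlinarith
  refine ⟨hint, ?_, ?_⟩
  · have h1 : ∫ _ in G, (1 - η) ^ 2 * P ∂Pr ≤
        ∫ ω in G, ∑ i ∈ Finset.range (R ω), b (C i ω) ∂Pr :=
      setIntegral_mono_on (integrable_const _).integrableOn hint.integrableOn hG
        fun ω hω => (hgood ω hω).1
    have h2 := setIntegral_le_integral (s := G) hint (ae_of_all _ hnonneg)
    rw [setIntegral_const, smul_eq_mul] at h1
    refine le_trans ?_ (h1.trans h2)
    have h3 : 1 - δ ≤ Pr.real G * (1 - η) ^ 2 := by
      have h4 : 1 - η ≤ Pr.real G := by linarith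
      have := mul_le_mul_of_nonneg_right h4 (sq_nonneg (1 - η))
      nlinarith [sq_nonneg η, mul_nonneg hη.le (sub_nonneg.2 hη1)]
    calc (1 - δ) * P ≤ Pr.real G * (1 - η) ^ 2 * P := mul_le_mul_of_nonneg_right h3 hP.le
      _ = _ := by ring
  · rw [← integral_add_compl hG hint]
    have h1 : ∫ ω in G, ∑ i ∈ Finset.range (R ω), b (C i ω) ∂Pr ≤
        ∫ _ in G, (1 + η) * (1 + 2 * η) * P ∂Pr :=
      setIntegral_mono_on hint.integrableOn (integrable_const _).integrableOn hG
        fun ω hω => (hgood ω hω).2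
    have h2 : ∫ ω in Gᶜ, ∑ i ∈ Finset.range (R ω), b (C i ω) ∂Pr ≤
        ∫ _ in Gᶜ, 2 / κ ^ 2 * P ∂Pr :=
      setIntegral_mono_on hint.integrableOn (integrable_const _).integrableOn hG.compl
        fun ω _ => hbad ω
    rw [setIntegral_const, smul_eq_mul] at h1 h2
    have h3 : Pr.real G * ((1 + η) * (1 + 2 * η) * P) ≤ (1 + η) * (1 + 2 * η) * P :=
      mul_le_of_le_one_left (by positivity) hG1
    have h4 : Pr.real Gᶜ * (2 / κ ^ 2 * P) ≤ η * P := by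
      calc Pr.real Gᶜ * (2 / κ ^ 2 * P) ≤ η * (κ ^ 2 / 2) * (2 / κ ^ 2 * P) :=
            mul_le_mul_of_nonneg_right hGc (by positivity)
        _ = η * P := by field_simp
    have h5 : (1 + η) * (1 + 2 * η) + η ≤ 1 + δ := by nlinarith
    have h6 := mul_le_mul_of_nonneg_right h5 hP.le
    linarith

end FLComp

theorem lemma2 {m : ℕ} {qmax : ℝ} (hqmax : 0 ≤ qmax)
    {S : Type*} [Fintype S] [DecidableEq S] [MeasurableSpace S] [MeasurableSingletonClass S]
    {Ω : Type*} [MeasurableSpace Ω] (Pr : Measure Ω) [IsProbabilityMeasure Pr]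
    (reached : FLComp.Convergence m qmax)
    (h : ℝ → Set.Icc (0 : ℝ) qmax → ℝ) (N : Seminorm ℝ (Fin m → ℝ))
    (hRounds : FLComp.RoundsCriterion reached h N)
    (hGrowth : FLComp.RoundsGrowth reached)
    (d : ℕ → FLComp.CompVec m qmax → S → ℝ) (τ : ℕ)
    (hDuration : FLComp.DurationAssumption d τ h)
    (C : ℕ → Ω → S) (M : Matrix S S ℝ) (μ : S → ℝ)
    (hMarkov : FLComp.IsStationaryMarkovChain Pr C M μ)
    (δ : ℝ) (hδ : 0 < δ) :
    ∃ εth : ℝ, 0 < εth ∧ ∀ ε : ℝ, 0 < ε → ε < εth → ∀ π : S → FLComp.CompVec m qmax,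
      (∀ ω, IsLeast {r : ℕ | 1 ≤ r ∧ reached ε (FLComp.policySeq π C ω) r}
        (FLComp.policyRounds reached ε π C ω)) ∧
      Integrable (FLComp.wallClock reached d τ ε π C) Pr ∧
      0 < FLComp.mean μ (fun c => N (FLComp.vecH (h ε) (π c))) *
        FLComp.mean μ (fun c => d τ (π c) c) ∧
      1 - δ ≤ (∫ ω, FLComp.wallClock reached d τ ε π C ω ∂Pr) /
        (FLComp.mean μ (fun c => N (FLComp.vecH (h ε) (π c))) *
          FLComp.mean μ (fun c => d τ (π c) c)) ∧
      (∫ ω, FLComp.wallClock reached d τ ε π C ω ∂Pr) /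
        (FLComp.mean μ (fun c => N (FLComp.vecH (h ε) (π c))) *
          FLComp.mean μ (fun c => d τ (π c) c)) ≤ 1 + δ := by

  obtain ⟨A, hA, hmain⟩ := hMarkov.integral_sum_stop_bounds hδ
  -- `A` depends only on the chain and `δ`, and the rate bound holds for all compression vectors, so
  -- `εth` can be fixed before `π`.
  obtain ⟨εth, hεth, hrate⟩ := FLComp.rate_large hqmax hRounds hGrowth A
  refine ⟨εth, hεth, fun ε hε hεth π => ?_⟩
  let a : S → ℝ := fun c => N (FLComp.vecH (h ε) (π c))
  let b : S → ℝ := fun c => d τ (π c) c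
  have ha : ∀ s, A ≤ a s := fun s => (hrate ε hε hεth (π s)).le
  have hb : ∀ s, 0 < b s := fun s => hDuration.pos s (π s)
  have hleast : ∀ ω, IsLeast {r : ℕ | 1 ≤ r ∧ reached ε (FLComp.policySeq π C ω) r}
      (FLComp.policyRounds reached ε π C ω) := by
    intro ω
    refine ⟨Nat.sInf_mem ?_, fun r hr => Nat.sInf_le hr⟩
    rw [hRounds.setOf_reached hε]
    exact FLComp.exists_stop (fun i => C i ω) a
  have hP : 0 < FLComp.mean μ a * FLComp.mean μ b :=
    mul_pos (hA.trans_le (FLComp.le_mean hMarkov.distribution ha))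
      (FLComp.mean_pos hMarkov.distribution hb)
  obtain ⟨hint, hlow, hupp⟩ := hmain a b ha hb (FLComp.policyRounds reached ε π C) fun ω => by
    have := hleast ω
    rwa [hRounds.setOf_reached hε] at this
  exact ⟨hleast, hint, hP, (le_div_iff₀ hP).2 hlow, (div_le_iff₀ hP).2 hupp⟩
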